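/- Let $F$ be a field with $\operatorname{char} F\neq 2$, let $m\geq 1$, and let $UT_m(F)$ be the algebra of upper triangular $m\times m$ matrices over $F$ with matrix units $e_{ij}$, $i\le j$. Let $G$ be an arbitrary group (written multiplicatively). A $G$-grading on an $F$-algebra $A$ is a vector space decomposition $A=\bigoplus_{g\in G}A_g$ with $A_gA_h\subseteq A_{gh}$. An involution is an $F$-linear map $\circ$ with $(a^{\circ})^{\circ}=a$ and $(ab)^{\circ}=b^{\circ}a^{\circ}$; it is graded if $A_g^{\circ}\subseteq A_g$ for all $g$. Two $G$-graded algebras with graded involution are isomorphic if there is an algebra isomorphism between them that maps the component of degree $g$ onto the component of degree $g$, for every $g$, and commutes with the involutions. The elementary grading on $UT_m(F)$ induced by $(t_1,\dots,t_m)\in G^m$ is the one in which $e_{ij}$ has degree $t_it_j^{-1}$. For a homomorphism $\alpha:H\to G$ of groups, the coarsening of an $H$-grading $\bigoplus_{h\in H} A_h$ induced by $\alpha$ is the $G$-grading with components $A'_g=\bigoplus_{h\in\alpha^{-1}(g)}A_h$. Put $r=\lfloor m/2\rfloor$ and let $e_1,\dots,e_r$ be the standard basis of $\mathbb{Z}^r$.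 The finest grading on $UT_m(F)$ is the elementary $\mathbb{Z}^r$-grading induced by $(e_1,\dots,e_r,0,e_r-e_{r-1},\dots,e_r-e_1)$ if $m=2r$, and by $(e_1,\dots,e_r,0,-e_r,\dots,-e_1)$ if $m=2r+1$. The reflection involution $\ast$ is given by $e_{ij}^{\ast}=e_{m+1-j,\,m+1-i}$. If $m=2r$, the symplectic involution $s$ is given by $a^{s}=Da^{\ast}D^{-1}$, where $D=\operatorname{diag}(I_r,-I_r)$. Let $UT_m(F)$ be endowed with a $G$-grading and a graded involution $\circ$. Then there exists a homomorphism of groups $\alpha:\mathbb{Z}^{\lfloor m/2\rfloor}\to G$ such that $UT_m(F)$ with this grading and $\circ$ is isomorphic, as a $G$-graded algebra with involution, to $UT_m(F)$ with the coarsening of the finest grading induced by $\alpha$ and with either the reflection involution or, if $m$ is even, possibly the symplectic involution. -/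

import Mathlib

/-- The algebra `UT_m(F)` of upper triangular `m × m` matrices over `F`. -/
def UT (m : ℕ) (F : Type*) [Field F] : Subalgebra F (Matrix (Fin m) (Fin m) F) where
  carrier := {M | M.IsUpperTriangular}
  mul_mem' h₁ h₂ := Matrix.BlockTriangular.mul h₁ h₂
  add_mem' h₁ h₂ := Matrix.BlockTriangular.add h₁ h₂
  algebraMap_mem' c := by
    rw [Matrix.algebraMap_eq_diagonal]
    exact Matrix.blockTriangular_diagonal _

section Gradings

variable {F A : Type*} [Field F] [Ring A] [Algebra F A]

open Classical in
/-- The family `𝒜` of subspaces is a grading of the algebra `A` by the group `G`. -/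
structure IsGroupGrading {G : Type*} [Group G] (𝒜 : G → Submodule F A) : Prop where
  isInternal : DirectSum.IsInternal 𝒜
  mul_mem : ∀ (g h : G) (a b : A), a ∈ 𝒜 g → b ∈ 𝒜 h → a * b ∈ 𝒜 (g * h)

/-- `σ` is an involution of the `F`-algebra `A` (of the first kind). -/
structure IsAlgInvolution (σ : A →ₗ[F] A) : Prop where
  apply_apply : ∀ a, σ (σ a) = a
  map_mul : ∀ a b, σ (a * b) = σ b * σ a

/-- `σ` is a graded involution of `A` with the `G`-grading `𝒜`. -/
structure IsGradedInvolution {G : Type*} (𝒜 : G → Submodule F A) (σ : A →ₗ[F] A) : Prop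
    extends IsAlgInvolution σ where
  map_mem : ∀ (g : G) (a : A), a ∈ 𝒜 g → σ a ∈ 𝒜 g

/-- The coarsening of the `G`-grading `𝒜` induced by the homomorphism `α : G →* H`: the component
of degree `h` is the sum of all `𝒜 g` with `α g = h`. -/
def inducedCoarsening {G H : Type*} [Group G] [Group H] (α : G →* H) (𝒜 : G → Submodule F A) :
    H → Submodule F A :=
  fun h => ⨆ g ∈ α ⁻¹' {h}, 𝒜 g

/-- `(A, 𝒜, σ)` and `(B, ℬ, τ)` are isomorphic as `G`-graded algebras with involution: there is an
isomorphism of algebras which maps each `𝒜 g` onto `ℬ g` and commutes with the involutions. -/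
def IsomorphicGradedInvolution {B : Type*} [Ring B] [Algebra F B] {G : Type*}
    (𝒜 : G → Submodule F A) (σ : A →ₗ[F] A) (ℬ : G → Submodule F B) (τ : B →ₗ[F] B) : Prop :=
  ∃ φ : A ≃ₐ[F] B, (∀ (g : G) (a : A), φ a ∈ ℬ g ↔ a ∈ 𝒜 g) ∧ ∀ a : A, φ (σ a) = τ (φ a)

end Gradings

/-- The elementary `G`-grading on `UT_m(F)` induced by the tuple `t`: the component of degree `g`
is spanned by the matrix units `e_{ij}`, `i ≤ j`, with `t i * (t j)⁻¹ = g`; that is, it consists of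
the upper triangular matrices which vanish at all other positions. -/
def elementaryGrading {m : ℕ} (F : Type*) [Field F] {G : Type*} [Group G] (t : Fin m → G) (g : G) :
    Submodule F (UT m F) where
  carrier := {M | ∀ i j, i ≤ j → t i * (t j)⁻¹ ≠ g → M.1 i j = 0}
  add_mem' {M N} hM hN i j hij hg := by
    change M.1 i j + N.1 i j = 0
    rw [hM i j hij hg, hN i j hij hg, add_zero]
  zero_mem' _ _ _ _ := rfl
  smul_mem' c M hM i j hij hg := by
    change c * M.1 i j = 0
    rw [hM i j hij hg, mul_zero]

/-- The standard vector of `ℤ^r` whose entry with (zero-based) index `k` is `1`. -/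
def stdVec (r k : ℕ) : Fin r → ℤ := fun l => if (l : ℕ) = k then 1 else 0

/-- The tuple `(e_1, …, e_r, 0, e_r - e_{r-1}, …, e_r - e_1)` for `m = 2 r` and
`(e_1, …, e_r, 0, -e_r, …, -e_1)` for `m = 2 r + 1`, with all indices shifted to start at `0`. -/
def finestTuple (m : ℕ) (i : Fin m) : Fin (m / 2) → ℤ :=
  if (i : ℕ) < m / 2 then stdVec (m / 2) i
  else if (i : ℕ) = m / 2 then 0
  else if Even m then stdVec (m / 2) (m / 2 - 1) - stdVec (m / 2) (m - 1 - i)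
  else -stdVec (m / 2) (m - 1 - i)

/-- The finest grading on `UT_m(F)`, by the group `ℤ^⌊m/2⌋` written multiplicatively. -/
def finestGrading (m : ℕ) (F : Type*) [Field F] :
    Multiplicative (Fin (m / 2) → ℤ) → Submodule F (UT m F) :=
  elementaryGrading F (fun i => Multiplicative.ofAdd (finestTuple m i))

/-- The reflection involution of `UT_m(F)`, the linear map with
`e_{ij} ↦ e_{m+1-j, m+1-i}`: reflection in the secondary diagonal. -/
def reflectionInvolution (m : ℕ) (F : Type*) [Field F] : UT m F →ₗ[F] UT m F where
  toFun M := ⟨Matrix.of fun i j => M.1 j.rev i.rev, fun _ _ h => M.2 (Fin.rev_lt_rev.2 h)⟩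
  map_add' _ _ := rfl
  map_smul' _ _ := rfl

/-- The matrix `diag(1, …, 1, -1, …, -1)` with `⌊m/2⌋` entries `1`. -/
def signMatrix (m : ℕ) (F : Type*) [Field F] : Matrix (Fin m) (Fin m) F :=
  Matrix.diagonal fun i => if (i : ℕ) < m / 2 then 1 else -1

/-- The map `M ↦ D M^* D⁻¹` on `UT_m(F)`, where `M^*` is the reflection of `M` and
`D = diag(I_r, -I_r)`. For `m = 2 r` this is the symplectic involution; for odd `m`
the definition is not meant to be used. -/
noncomputable def symplecticInvolution (m : ℕ) (F : Type*) [Field F] :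
    UT m F →ₗ[F] UT m F where
  toFun M := ⟨signMatrix m F * (reflectionInvolution m F M).1 * (signMatrix m F)⁻¹, by
    refine Matrix.BlockTriangular.mul (Matrix.BlockTriangular.mul
      (Matrix.blockTriangular_diagonal _) (reflectionInvolution m F M).2) ?_
    rw [signMatrix, Matrix.inv_diagonal]
    exact Matrix.blockTriangular_diagonal _⟩
  map_add' M N := by
    apply Subtype.ext
    simp [map_add, mul_add, add_mul]
  map_smul' c M := by
    apply Subtype.ext
    simp [map_smul]

/-! A graded involution forces commutators of homogeneous elements to be homogeneous: if `a * b ≠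
0`, the image of `a * b` has both product degrees, so the degrees commute. The radical `J` of
`UT_m(F)` is spanned by commutators, hence graded, and so are the submodules `column` of the last
column, which are cut out by annihilator conditions on `J`. A homogeneous basis of the last column
adapted to this filtration is a triangular change of basis that makes the grading elementary
(`exists_equiv_elementaryGrading`).

For an elementary grading, the first rows of the images of the units `e_{im}` form an invertible `u`
with `u * σ a = a^* * u` and `u^* = ε u`, `ε = ±1`. Comparing degrees shows that `u` has degree one
and that the `s_i = t_i t_m⁻¹` commute with `s_i s_{m+1-i}` constant. These are the relations of the
finest grading, so they yield `α` (`exists_monoidHom_finestTuple`).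

Finally `u = c p^* T p` with `p` of degree one and `T` either `1` or the sign matrix
(`exists_factorization`), and conjugation by `p` turns `σ` into the reflection or symplectic
involution without moving the grading. The unipotent part of `u` is removed by a square root,
available since `2 ≠ 0`; the scalar `c` is harmless, so no square roots of scalars are needed. -/

namespace IsGroupGrading

/-! ### Homogeneous components and graded subspaces -/

variable {F A G : Type*} [Field F] [Ring A] [Algebra F A] [Group G] {𝒜 : G → Submodule F A}

open Classical in
/-- The projection of a graded algebra onto its component of degree `g`. -/
noncomputable def proj (h : IsGroupGrading 𝒜) (g : G) : A →ₗ[F] A :=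
  letI := h.isInternal.chooseDecomposition
  (𝒜 g).subtype ∘ₗ DirectSum.component F G (fun g => 𝒜 g) g ∘ₗ
    (DirectSum.decomposeLinearEquiv 𝒜).toLinearMap

variable (h : IsGroupGrading 𝒜)

lemma proj_mem (g : G) (a : A) : h.proj g a ∈ 𝒜 g := Submodule.coe_mem _

lemma proj_of_mem {g : G} {a : A} (ha : a ∈ 𝒜 g) : h.proj g a = a := by
  classical
  let := h.isInternal.chooseDecomposition
  exact DirectSum.decompose_of_mem_same 𝒜 ha

lemma proj_of_mem_ne {g k : G} {a : A} (ha : a ∈ 𝒜 g) (hgk : g ≠ k) : h.proj k a = 0 := by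
  classical
  let := h.isInternal.chooseDecomposition
  exact DirectSum.decompose_of_mem_ne 𝒜 ha hgk

include h in
lemma induction_on {p : A → Prop} (zero : p 0) (mem : ∀ g, ∀ a ∈ 𝒜 g, p a)
    (add : ∀ a b, p a → p b → p (a + b)) (a : A) : p a := by
  classical
  let := h.isInternal.chooseDecomposition
  exact DirectSum.Decomposition.inductionOn 𝒜 zero (fun m => mem _ _ m.2) add a

lemma mem_of_proj_mem {V : Submodule F A} {a : A} (ha : ∀ g, h.proj g a ∈ V) : a ∈ V := by
  classical
  let := h.isInternal.chooseDecomposition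
  rw [← DirectSum.sum_support_decompose 𝒜 a]
  exact V.sum_mem fun g _ => ha g

lemma proj_mul_right {k : G} (g : G) (a : A) {b : A} (hb : b ∈ 𝒜 k) :
    h.proj (g * k) (a * b) = h.proj g a * b := by
  refine h.induction_on (p := fun a => h.proj (g * k) (a * b) = h.proj g a * b) (by simp)
    (fun l a ha => ?_) (fun a₁ a₂ h₁ h₂ => by simp only [add_mul, map_add, h₁, h₂]) a
  by_cases hl : l = g
  · subst hl
    rw [h.proj_of_mem ha, h.proj_of_mem (h.mul_mem _ _ _ _ ha hb)]
  · rw [h.proj_of_mem_ne ha hl, zero_mul,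
      h.proj_of_mem_ne (h.mul_mem _ _ _ _ ha hb) fun e => hl (mul_right_cancel e)]

lemma proj_mul_left {k : G} (g : G) {a : A} (b : A) (ha : a ∈ 𝒜 k) :
    h.proj (k * g) (a * b) = a * h.proj g b := by
  refine h.induction_on (p := fun b => h.proj (k * g) (a * b) = a * h.proj g b) (by simp)
    (fun l b hb => ?_) (fun a₁ a₂ h₁ h₂ => by simp only [mul_add, map_add, h₁, h₂]) b
  by_cases hl : l = g
  · subst hl
    rw [h.proj_of_mem hb, h.proj_of_mem (h.mul_mem _ _ _ _ ha hb)]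
  · rw [h.proj_of_mem_ne hb hl, mul_zero,
      h.proj_of_mem_ne (h.mul_mem _ _ _ _ ha hb) fun e => hl (mul_left_cancel e)]

/-- A subspace is graded if it contains the homogeneous components of its elements. -/
def IsGradedSubspace (V : Submodule F A) : Prop := ∀ g, ∀ a ∈ V, h.proj g a ∈ V

variable {h}

/-- On homogeneous `u` of degree `k`, `h.proj g a * u` is the component of `a * u` of degree `g *
k`. Hence annihilator-type conditions between graded subspaces pass to components. -/
lemma proj_mul_mem_of_left {U V : Submodule F A} (hU : h.IsGradedSubspace U)
    (hV : h.IsGradedSubspace V) {a : A} (ha : ∀ u ∈ U, a * u ∈ V) (g : G) {u : A} (hu : u ∈ U) :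
    h.proj g a * u ∈ V := by
  refine h.mem_of_proj_mem (V := V.comap (LinearMap.mulLeft F (h.proj g a))) fun k => ?_
  change h.proj g a * h.proj k u ∈ V
  rw [← h.proj_mul_right g a (h.proj_mem k u)]
  exact hV _ _ (ha _ (hU k u hu))

lemma mul_proj_mem_of_right {U V : Submodule F A} (hU : h.IsGradedSubspace U)
    (hV : h.IsGradedSubspace V) {a : A} (ha : ∀ u ∈ U, u * a ∈ V) (g : G) {u : A} (hu : u ∈ U) :
    u * h.proj g a ∈ V := by
  refine h.mem_of_proj_mem (V := V.comap (LinearMap.mulRight F (h.proj g a))) fun k => ?_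
  change h.proj k u * h.proj g a ∈ V
  rw [← h.proj_mul_left g a (h.proj_mem k u)]
  exact hV _ _ (ha _ (hU k u hu))

variable (h)

/-! ### Commutators in the presence of a graded involution -/

include h in
/-- In an algebra with graded involution, commutators of homogeneous elements are homogeneous. -/
lemma exists_commutator_mem {σ : A →ₗ[F] A} (hσ : IsGradedInvolution 𝒜 σ) {k l : G} {a b : A}
    (ha : a ∈ 𝒜 k) (hb : b ∈ 𝒜 l) : ∃ g, a * b - b * a ∈ 𝒜 g := by
  -- If `a * b = 0`, only one term is left. Otherwise `σ (a * b)` is a nonzero element of degrees `k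
  -- * l` and `l * k`, so these agree.
  by_cases hab : a * b = 0
  · refine ⟨l * k, ?_⟩
    rw [hab, zero_sub]
    exact neg_mem (h.mul_mem _ _ _ _ hb ha)
  · have hkl : k * l = l * k := by
      by_contra hne
      have h₁ := hσ.map_mem _ _ (h.mul_mem _ _ _ _ ha hb)
      have h₂ : σ (a * b) ∈ 𝒜 (l * k) := by
        rw [hσ.map_mul]
        exact h.mul_mem _ _ _ _ (hσ.map_mem _ _ hb) (hσ.map_mem _ _ ha)
      have h₃ : σ (a * b) = 0 := by
        rw [← h.proj_of_mem h₁, h.proj_of_mem_ne h₂ (Ne.symm hne)]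
      apply hab
      rw [← hσ.apply_apply (a * b), h₃, map_zero]
    refine ⟨k * l, sub_mem (h.mul_mem _ _ _ _ ha hb) ?_⟩
    rw [hkl]
    exact h.mul_mem _ _ _ _ hb ha

/-- In an algebra with graded involution, the components of a commutator lie in any subspace
containing all commutators. -/
lemma proj_commutator_mem {σ : A →ₗ[F] A} (hσ : IsGradedInvolution 𝒜 σ) {V : Submodule F A}
    (hV : ∀ a b : A, a * b - b * a ∈ V) (g : G) (a b : A) : h.proj g (a * b - b * a) ∈ V := by
  refine h.induction_on (p := fun a => h.proj g (a * b - b * a) ∈ V) (by simp) (fun k a ha => ?_)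
    (fun a₁ a₂ h₁ h₂ => ?_) a
  · refine h.induction_on (p := fun b => h.proj g (a * b - b * a) ∈ V) (by simp) (fun l b hb => ?_)
      (fun b₁ b₂ h₁ h₂ => ?_) b
    · obtain ⟨s, hs⟩ := h.exists_commutator_mem hσ ha hb
      by_cases hsg : s = g
      · subst hsg
        rw [h.proj_of_mem hs]
        exact hV _ _
      · rw [h.proj_of_mem_ne hs hsg]
        exact V.zero_mem
    · rw [show a * (b₁ + b₂) - (b₁ + b₂) * a = (a * b₁ - b₁ * a) + (a * b₂ - b₂ * a) by noncomm_ring,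
        map_add]
      exact V.add_mem h₁ h₂
  · rw [show (a₁ + a₂) * b - b * (a₁ + a₂) = (a₁ * b - b * a₁) + (a₂ * b - b * a₂) by noncomm_ring,
      map_add]
    exact V.add_mem h₁ h₂

end IsGroupGrading

/-! ### Transport of structure, inverses and square roots -/

section Transport

variable {F A B C : Type*} [Field F] [Ring A] [Algebra F A] [Ring B] [Algebra F B]
  [Ring C] [Algebra F C] {G : Type*}

lemma IsomorphicGradedInvolution.trans {𝒜 : G → Submodule F A} {σ : A →ₗ[F] A}
    {ℬ : G → Submodule F B} {τ : B →ₗ[F] B} {𝒞 : G → Submodule F C} {ρ : C →ₗ[F] C}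
    (h₁ : IsomorphicGradedInvolution 𝒜 σ ℬ τ) (h₂ : IsomorphicGradedInvolution ℬ τ 𝒞 ρ) :
    IsomorphicGradedInvolution 𝒜 σ 𝒞 ρ := by
  obtain ⟨φ, hφ, hφσ⟩ := h₁
  obtain ⟨ψ, hψ, hψσ⟩ := h₂
  exact ⟨φ.trans ψ, fun g a => (hψ g _).trans (hφ g a), fun a => by simp [hφσ, hψσ]⟩

/-- A graded involution can be transported along an isomorphism of graded algebras. -/
lemma exists_isomorphicGradedInvolution {𝒜 : G → Submodule F A} {σ : A →ₗ[F] A}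
    (hσ : IsGradedInvolution 𝒜 σ) {ℬ : G → Submodule F B} (φ : A ≃ₐ[F] B)
    (hφ : ∀ g a, φ a ∈ ℬ g ↔ a ∈ 𝒜 g) :
    ∃ τ : B →ₗ[F] B, IsGradedInvolution ℬ τ ∧ IsomorphicGradedInvolution 𝒜 σ ℬ τ := by
  refine ⟨φ.toLinearMap ∘ₗ σ ∘ₗ φ.symm.toLinearMap, ⟨⟨fun a => ?_, fun a b => ?_⟩,
    fun g a ha => ?_⟩, φ, hφ, fun a => ?_⟩
  · simp [hσ.apply_apply]
  · simp [hσ.map_mul]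
  · have : φ.symm a ∈ 𝒜 g := by rwa [← hφ, φ.apply_symm_apply]
    exact (hφ _ _).2 (hσ.map_mem _ _ this)
  · simp

/-- Conjugation by a unit. -/
def unitConj (u : Aˣ) : A ≃ₐ[F] A :=
  AlgEquiv.ofAlgHom
    { toFun := fun a => u * a * (u⁻¹ : Aˣ)
      map_one' := by simp
      map_mul' := fun a b => by simp [mul_assoc]
      map_zero' := by simp
      map_add' := fun a b => by simp [mul_add, add_mul]
      commutes' := fun c => by simp [← Algebra.commutes c (u : A), mul_assoc] }
    { toFun := fun a => (u⁻¹ : Aˣ) * a * u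
      map_one' := by simp
      map_mul' := fun a b => by simp [mul_assoc]
      map_zero' := by simp
      map_add' := fun a b => by simp [mul_add, add_mul]
      commutes' := fun c => by simp [← Algebra.commutes c ((u⁻¹ : Aˣ) : A), mul_assoc] }
    (by ext a; simp [mul_assoc]) (by ext a; simp [mul_assoc])

lemma unitConj_apply (u : Aˣ) (a : A) : unitConj (F := F) u a = u * a * (u⁻¹ : Aˣ) := rfl

/-- A subalgebra of a finite-dimensional algebra contains the inverses of its invertible
elements. -/
lemma Subalgebra.exists_mul_eq_one_of_isUnit [FiniteDimensional F A] (S : Subalgebra F A) {p : A}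
    (hp : p ∈ S) (hu : IsUnit p) : ∃ q ∈ S, p * q = 1 ∧ q * p = 1 := by
  have hinj : Function.Injective (LinearMap.mulLeft F (⟨p, hp⟩ : S)) := fun x y hxy => by
    have : p * x = p * y := congrArg Subtype.val hxy
    exact Subtype.ext (hu.mul_left_cancel this)
  obtain ⟨q, hq⟩ := LinearMap.injective_iff_surjective.1 hinj 1
  have h1 : p * (q : A) = 1 := congrArg Subtype.val hq
  refine ⟨q, q.2, h1, hu.mul_left_cancel ?_⟩
  rw [← mul_assoc, h1, one_mul, mul_one]

/-- Over a field of characteristic not two, a unipotent element has a square root which is a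
polynomial in that element. -/
lemma exists_aeval_sq_eq (hF : (2 : F) ≠ 0) {u : A} (hu : IsNilpotent (u - 1)) :
    ∃ f : Polynomial F, (Polynomial.aeval u f) ^ 2 = u := by
  have := Algebra.isMulCommutative_adjoin F (s := {u}) (by simp)
  let v : Algebra.adjoin F {u} := ⟨u, Algebra.self_mem_adjoin_singleton F u⟩
  have hv : IsNilpotent (1 - v) := by
    obtain ⟨n, hn⟩ := hu
    refine ⟨n, Subtype.ext ?_⟩
    have : (1 - u) ^ n = 0 := by rw [← neg_sub, neg_pow, hn, mul_zero]
    simpa using this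
  have h2 : IsUnit (2 : Algebra.adjoin F {u}) := by
    have := (isUnit_iff_ne_zero.2 hF).map (algebraMap F (Algebra.adjoin F {u}))
    rwa [map_ofNat] at this
  -- Newton iteration for `X ^ 2 - v` in the commutative ring `F[u]`, starting at `1`: the value `1
  -- - v` is nilpotent and the derivative `2` is a unit.
  obtain ⟨r, ⟨-, hr⟩, -⟩ := Polynomial.existsUnique_nilpotent_sub_and_aeval_eq_zero
    (R := Algebra.adjoin F {u}) (P := Polynomial.X ^ 2 - Polynomial.C v) (x := (1 : Algebra.adjoin F {u}))
    (by simpa using hv) (by simpa [one_add_one_eq_two] using h2)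
  have hr' : r ^ 2 = v := by simpa [sub_eq_zero] using hr
  obtain ⟨f, hf⟩ : (r : A) ∈ (Polynomial.aeval (R := F) u).range := by
    rw [← Algebra.adjoin_singleton_eq_range_aeval]
    exact r.2
  refine ⟨f, ?_⟩
  have hf' : Polynomial.aeval u f = (r : A) := hf
  rw [hf']
  exact congrArg Subtype.val hr'

end Transport

/-! ### Triangular matrices and their radical -/

namespace UT

variable {F : Type*} [Field F]

section Basic

variable {m : ℕ}

lemma apply_eq_zero (a : UT m F) {i j : Fin m} (h : j < i) : a.1 i j = 0 := a.2 h

lemma mul_apply (a b : UT m F) (i j : Fin m) : (a * b).1 i j = ∑ k, a.1 i k * b.1 k j := rfl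

lemma ext_apply {a b : UT m F} (h : ∀ i j, i ≤ j → a.1 i j = b.1 i j) : a = b := by
  refine Subtype.ext (Matrix.ext fun i j => ?_)
  rcases le_or_gt i j with hij | hij
  · exact h i j hij
  · rw [apply_eq_zero a hij, apply_eq_zero b hij]

/-- The matrix unit `e_{ij}`, for `i ≤ j`. -/
def unit (F : Type*) [Field F] {i j : Fin m} (h : i ≤ j) : UT m F :=
  ⟨Matrix.single i j 1, fun k l hkl => by
    rw [Matrix.single_apply, if_neg]
    rintro ⟨rfl, rfl⟩
    exact absurd h (not_le.2 hkl)⟩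

lemma unit_apply {i j : Fin m} (h : i ≤ j) (k l : Fin m) :
    (unit F h).1 k l = if i = k ∧ j = l then 1 else 0 := Matrix.single_apply ..

lemma mul_unit_apply (a : UT m F) {i j : Fin m} (h : i ≤ j) (k l : Fin m) :
    (a * unit F h).1 k l = if j = l then a.1 k i else 0 := by
  simp [mul_apply, unit_apply, ite_and]

lemma unit_mul_apply (a : UT m F) {i j : Fin m} (h : i ≤ j) (k l : Fin m) :
    (unit F h * a).1 k l = if i = k then a.1 j l else 0 := by
  simp [mul_apply, unit_apply, ite_and]

lemma diag_mul (a b : UT m F) (i : Fin m) : (a * b).1 i i = a.1 i i * b.1 i i := by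
  rw [mul_apply, Finset.sum_eq_single i]
  · intro k _ hk
    rcases lt_or_gt_of_ne hk with h | h
    · rw [apply_eq_zero a h, zero_mul]
    · rw [apply_eq_zero b h, mul_zero]
  · simp

/-- The diagonal matrix with given entries. -/
def diag (d : Fin m → F) : UT m F := ⟨Matrix.diagonal d, Matrix.blockTriangular_diagonal _⟩

lemma diag_apply (d : Fin m → F) (i j : Fin m) : (diag d).1 i j = if i = j then d i else 0 :=
  Matrix.diagonal_apply ..

lemma diag_mul_apply (d : Fin m → F) (a : UT m F) (i j : Fin m) :
    (diag d * a).1 i j = d i * a.1 i j := Matrix.diagonal_mul ..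

lemma mul_diag_apply (d : Fin m → F) (a : UT m F) (i j : Fin m) :
    (a * diag d).1 i j = a.1 i j * d j := Matrix.mul_diagonal ..

lemma isUnit_of_diag_ne_zero {a : UT m F} (h : ∀ i, a.1 i i ≠ 0) : IsUnit a := by
  have hdet : IsUnit a.1 := by
    rw [Matrix.isUnit_iff_isUnit_det, Matrix.det_of_isUpperTriangular a.2, isUnit_iff_ne_zero]
    exact Finset.prod_ne_zero_iff.2 fun i _ => h i
  obtain ⟨q, hq, h₁, h₂⟩ := (UT m F).exists_mul_eq_one_of_isUnit a.2 hdet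
  exact ⟨⟨a, ⟨q, hq⟩, Subtype.ext h₁, Subtype.ext h₂⟩, rfl⟩

lemma isNilpotent_of_diag_eq_zero {a : UT m F} (h : ∀ i, a.1 i i = 0) : IsNilpotent a := by
  refine ⟨m, Subtype.ext ?_⟩
  have := Matrix.aeval_self_charpoly a.1
  rw [Matrix.charpoly_of_isUpperTriangular _ a.2] at this
  simpa [h] using this

/-- The strictly upper triangular matrices. -/
def radical (m : ℕ) (F : Type*) [Field F] : Submodule F (UT m F) where
  carrier := {a | ∀ i, a.1 i i = 0}
  add_mem' {a b} ha hb i := by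
    change a.1 i i + b.1 i i = 0
    rw [ha i, hb i, add_zero]
  zero_mem' _ := rfl
  smul_mem' c a ha i := by
    change c * a.1 i i = 0
    rw [ha i, mul_zero]

lemma commutator_mem_radical (a b : UT m F) : a * b - b * a ∈ radical m F := fun i => by
  change (a * b).1 i i - (b * a).1 i i = 0
  rw [diag_mul, diag_mul, mul_comm, sub_self]

/-- The commutator of `e_{ii}` with `e_{ii} a` is the `i`-th row of `a` without its diagonal entry.
Thus the radical is the span of the commutators, which makes it visible to both gradings and
involutions. -/
lemma eq_sum_commutator_of_mem_radical {a : UT m F} (ha : a ∈ radical m F) :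
    a = ∑ i, (unit F (le_refl i) * (unit F (le_refl i) * a) -
      (unit F (le_refl i) * a) * unit F (le_refl i)) := by
  refine ext_apply fun k l _ => ?_
  have : (∑ i, (unit F (le_refl i) * (unit F (le_refl i) * a) -
      (unit F (le_refl i) * a) * unit F (le_refl i))).1 k l =
      ∑ i, ((unit F (le_refl i) * (unit F (le_refl i) * a)).1 k l -
      ((unit F (le_refl i) * a) * unit F (le_refl i)).1 k l) := by
    rw [AddSubmonoidClass.coe_finsetSum, Matrix.sum_apply]
    rfl
  rw [this]
  simp only [unit_mul_apply, mul_unit_apply]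
  rw [Finset.sum_eq_single k]
  · by_cases hkl : k = l
    · subst hkl
      simp [ha k]
    · simp [hkl]
  · intro i _ hi
    simp [hi]
  · simp

lemma unit_mem_radical {i j : Fin m} (h : i < j) : unit F h.le ∈ radical m F := fun k => by
  rw [unit_apply, if_neg]
  rintro ⟨rfl, rfl⟩
  exact lt_irrefl _ h

lemma map_mem_radical {σ : UT m F →ₗ[F] UT m F} (hσ : IsAlgInvolution σ) {a : UT m F}
    (ha : a ∈ radical m F) : σ a ∈ radical m F := by
  rw [eq_sum_commutator_of_mem_radical ha, map_sum]
  refine Submodule.sum_mem _ fun i _ => ?_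
  rw [map_sub, hσ.map_mul, hσ.map_mul (unit F _ * a)]
  exact commutator_mem_radical _ _

end Basic

/-! ### The filtered last column, and reduction to elementary gradings -/

section Column

variable {n : ℕ}

/-- The matrices all of whose nonzero entries lie in the last column and the first `k` rows. -/
def column (n : ℕ) (F : Type*) [Field F] (k : ℕ) : Submodule F (UT (n + 1) F) where
  carrier := {a | ∀ i j, a.1 i j ≠ 0 → j = Fin.last n ∧ (i : ℕ) < k}
  add_mem' {a b} ha hb i j h := by
    by_cases h' : a.1 i j = 0
    · refine hb i j fun h'' => h ?_
      change a.1 i j + b.1 i j = 0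
      rw [h', h'', add_zero]
    · exact ha i j h'
  zero_mem' _ _ h := absurd rfl h
  smul_mem' c a ha i j h := ha i j fun h' => h (by change c * a.1 i j = 0; rw [h', mul_zero])

/-- The matrices all of whose nonzero entries lie in the first row and the last `k` columns. -/
def row (n : ℕ) (F : Type*) [Field F] (k : ℕ) : Submodule F (UT (n + 1) F) where
  carrier := {a | ∀ i j, a.1 i j ≠ 0 → i = 0 ∧ n + 1 ≤ j + k}
  add_mem' {a b} ha hb i j h := by
    by_cases h' : a.1 i j = 0
    · refine hb i j fun h'' => h ?_
      change a.1 i j + b.1 i j = 0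
      rw [h', h'', add_zero]
    · exact ha i j h'
  zero_mem' _ _ h := absurd rfl h
  smul_mem' c a ha i j h := ha i j fun h' => h (by change c * a.1 i j = 0; rw [h', mul_zero])

/-- Describes the filtration of the last column by multiplication with the radical alone, so that it
can be compared with the grading and the involution. -/
lemma mem_column_succ {a : UT (n + 1) F} {k : ℕ} :
    a ∈ column n F (k + 1) ↔ (∀ u ∈ radical (n + 1) F, a * u ∈ (⊥ : Submodule F (UT (n + 1) F))) ∧
      ∀ u ∈ radical (n + 1) F, u * a ∈ column n F k := by
  constructor
  · intro ha
    refine ⟨fun u hu => (Submodule.mem_bot F).2 (ext_apply fun i j _ => ?_), fun u hu i j hij => ?_⟩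
    · rw [mul_apply]
      refine Finset.sum_eq_zero fun l _ => ?_
      by_cases hl : a.1 i l = 0
      · rw [hl, zero_mul]
      · obtain ⟨rfl, -⟩ := ha i l hl
        rcases (Fin.le_last j).eq_or_lt with rfl | hj
        · rw [hu, mul_zero]
        · rw [apply_eq_zero u hj, mul_zero]
    · rw [mul_apply] at hij
      obtain ⟨l, -, hl⟩ := Finset.exists_ne_zero_of_sum_ne_zero hij
      obtain ⟨hj, hlk⟩ := ha l j (right_ne_zero_of_mul hl)
      refine ⟨hj, ?_⟩
      rcases lt_trichotomy i l with h | rfl | h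
      · have : (i : ℕ) < l := h
        omega
      · exact absurd (hu i) (left_ne_zero_of_mul hl)
      · exact absurd (apply_eq_zero u h) (left_ne_zero_of_mul hl)
  · rintro ⟨h₁, h₂⟩ i j hij
    refine ⟨?_, ?_⟩
    · by_contra hj
      have hj' : j < Fin.last n := (Fin.le_last j).lt_of_ne hj
      have := (Submodule.mem_bot F).1 (h₁ _ (unit_mem_radical hj'))
      apply hij
      have h0 : (a * unit F hj'.le).1 i (Fin.last n) = 0 := by rw [this]; rfl
      simpa [mul_unit_apply] using h0
    · by_cases hi : (i : ℕ) = 0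
      · omega
      · have hpos : (0 : Fin (n + 1)) < i := Fin.pos_iff_ne_zero.2 fun h => hi (by simp [h])
        let p : Fin (n + 1) := ⟨i - 1, by omega⟩
        have hp : p < i := Fin.lt_def.2 (by simp only [p]; omega)
        have := (h₂ _ (unit_mem_radical hp) p j (by rwa [unit_mul_apply, if_pos rfl])).2
        simp only [p] at this
        omega

lemma mem_row_succ {a : UT (n + 1) F} {k : ℕ} (h₁ : ∀ u ∈ radical (n + 1) F, u * a = 0)
    (h₂ : ∀ u ∈ radical (n + 1) F, a * u ∈ row n F k) : a ∈ row n F (k + 1) := by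
  intro i j hij
  refine ⟨?_, ?_⟩
  · by_contra hi
    have hi' : 0 < i := Fin.pos_iff_ne_zero.2 hi
    apply hij
    have h0 : (unit F hi'.le * a).1 0 j = 0 := by rw [h₁ _ (unit_mem_radical hi')]; rfl
    simpa [unit_mul_apply] using h0
  · by_cases hj : (j : ℕ) = n
    · omega
    · let p : Fin (n + 1) := ⟨j + 1, by omega⟩
      have hp : j < p := Fin.lt_def.2 (by simp only [p]; omega)
      have := (h₂ _ (unit_mem_radical hp) i p (by rwa [mul_unit_apply, if_pos rfl])).2
      simp only [p] at this
      omega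

/-- An involution preserves the radical and reverses products, so it exchanges the conditions
describing columns and rows. -/
lemma map_mem_row {σ : UT (n + 1) F →ₗ[F] UT (n + 1) F} (hσ : IsAlgInvolution σ) (k : ℕ) :
    ∀ a ∈ column n F k, σ a ∈ row n F k := by
  induction k with
  | zero =>
    intro a ha
    have : a = 0 := ext_apply fun i j _ => by
      by_contra h
      exact absurd (ha i j h).2 (Nat.not_lt_zero _)
    rw [this, map_zero]
    exact Submodule.zero_mem _
  | succ k ih =>
    intro a ha
    obtain ⟨h₁, h₂⟩ := mem_column_succ.1 ha
    refine mem_row_succ (fun u hu => ?_) fun u hu => ?_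
    · rw [← hσ.apply_apply u, ← hσ.map_mul,
        (Submodule.mem_bot F).1 (h₁ _ (map_mem_radical hσ hu)), map_zero]
    · rw [← hσ.apply_apply u, ← hσ.map_mul]
      exact ih _ (h₂ _ (map_mem_radical hσ hu))

lemma sum_smul_apply {ι : Type*} (s : Finset ι) (c : ι → F) (x : ι → UT (n + 1) F)
    (k l : Fin (n + 1)) : (∑ i ∈ s, c i • x i).1 k l = ∑ i ∈ s, c i * (x i).1 k l := by
  rw [AddSubmonoidClass.coe_finsetSum, Matrix.sum_apply]
  rfl

lemma mul_unit_last (a : UT (n + 1) F) (j : Fin (n + 1)) :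
    a * unit F (Fin.le_last j) = ∑ i, a.1 i j • unit F (Fin.le_last i) :=
  ext_apply fun k l _ => by
    rw [mul_unit_apply, sum_smul_apply]
    simp [unit_apply, ite_and]

variable {G : Type*} [Group G] {𝒜 : G → Submodule F (UT (n + 1) F)} (h : IsGroupGrading 𝒜)
  {σ : UT (n + 1) F →ₗ[F] UT (n + 1) F} (hσ : IsGradedInvolution 𝒜 σ)

include h hσ

lemma isGradedSubspace_radical : h.IsGradedSubspace (radical (n + 1) F) := fun g a ha => by
  rw [eq_sum_commutator_of_mem_radical ha, map_sum]
  exact Submodule.sum_mem _ fun i _ => h.proj_commutator_mem hσ commutator_mem_radical g _ _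

lemma isGradedSubspace_column (k : ℕ) : h.IsGradedSubspace (column n F k) := by
  induction k with
  | zero =>
    intro g a ha
    have : a = 0 := ext_apply fun i j _ => by
      by_contra h
      exact absurd (ha i j h).2 (Nat.not_lt_zero _)
    rw [this, map_zero]
    exact Submodule.zero_mem _
  | succ k ih =>
    intro g a ha
    obtain ⟨h₁, h₂⟩ := mem_column_succ.1 ha
    have hJ := isGradedSubspace_radical h hσ
    have hbot : h.IsGradedSubspace (⊥ : Submodule F (UT (n + 1) F)) := fun g a ha => by
      rw [(Submodule.mem_bot F).1 ha, map_zero]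
      exact Submodule.zero_mem _
    exact mem_column_succ.2 ⟨fun u hu => IsGroupGrading.proj_mul_mem_of_left hJ hbot h₁ g hu,
      fun u hu => IsGroupGrading.mul_proj_mem_of_right hJ ih h₂ g hu⟩

/-- The components of `e_{km}` stay in the graded subspace `column n F (k + 1)`, and they cannot all
vanish at the position where `e_{km}` has entry `1`. -/
lemma exists_homogeneous_column (k : Fin (n + 1)) :
    ∃ g : G, ∃ v ∈ 𝒜 g, v ∈ column n F (k + 1) ∧ v.1 k (Fin.last n) ≠ 0 := by
  have hk : unit F (Fin.le_last k) ∈ column n F (k + 1) := fun i j hij => by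
    rw [unit_apply] at hij
    obtain ⟨rfl, rfl⟩ := of_not_not fun h' => hij (if_neg h')
    exact ⟨rfl, by omega⟩
  by_contra! hcon
  let V : Submodule F (UT (n + 1) F) :=
    { carrier := {a | a.1 k (Fin.last n) = 0}
      add_mem' := fun {a b} ha hb => by
        change a.1 k (Fin.last n) + b.1 k (Fin.last n) = 0
        rw [show a.1 k (Fin.last n) = 0 from ha, show b.1 k (Fin.last n) = 0 from hb, add_zero]
      zero_mem' := rfl
      smul_mem' := fun c a ha => by
        change c * a.1 k (Fin.last n) = 0
        rw [show a.1 k (Fin.last n) = 0 from ha, mul_zero] }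
  have : unit F (Fin.le_last k) ∈ V := h.mem_of_proj_mem fun g =>
    hcon g _ (h.proj_mem g _) (isGradedSubspace_column h hσ _ g _ hk)
  have h0 : (unit F (Fin.le_last k)).1 k (Fin.last n) = 0 := this
  rw [unit_apply, if_pos ⟨rfl, rfl⟩] at h0
  exact one_ne_zero h0

/-- A grading of `UT_m(F)` which admits a graded involution is isomorphic to an elementary
grading. -/
theorem exists_equiv_elementaryGrading :
    ∃ (t : Fin (n + 1) → G) (φ : UT (n + 1) F ≃ₐ[F] UT (n + 1) F),
      ∀ g a, φ a ∈ elementaryGrading F t g ↔ a ∈ 𝒜 g := by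
  choose t v hvt hv hv0 using exists_homogeneous_column h hσ
  -- The columns of `P` are the homogeneous vectors `v k`; the filtration makes `P` upper triangular
  -- with nonzero diagonal.
  let P : UT (n + 1) F := ⟨Matrix.of fun i k => (v k).1 i (Fin.last n), fun i k hik => by
    by_contra hne
    have := (hv k i _ hne).2
    have h' : (k : ℕ) < i := hik
    omega⟩
  have hP : IsUnit P := isUnit_of_diag_ne_zero hv0
  obtain ⟨u, hu⟩ := hP
  have hPv : ∀ k, P * unit F (Fin.le_last k) = v k := fun k => ext_apply fun i j _ => by
    rw [mul_unit_apply]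
    split_ifs with hj
    · subst hj
      rfl
    · by_contra hne
      exact hj (hv k i j (Ne.symm hne)).1.symm
  have hinj : ∀ a : UT (n + 1) F, (∀ j, a * unit F (Fin.le_last j) = 0) → a = 0 :=
    fun a ha => ext_apply fun i j _ => by
      have h0 : (a * unit F (Fin.le_last j)).1 i (Fin.last n) = 0 := by rw [ha]; rfl
      simpa [mul_unit_apply] using h0
  -- in the basis `v` of the last column, `P * w * P⁻¹` acts as the matrix `w`
  have hmul : ∀ (w : UT (n + 1) F) j, (P * w * ↑u⁻¹) * v j = ∑ i, w.1 i j • v i := fun w j => by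
    rw [← hPv j, ← mul_assoc, mul_assoc (P * w), ← hu, Units.inv_mul, mul_one, hu, mul_assoc,
      mul_unit_last, Finset.mul_sum]
    exact Finset.sum_congr rfl fun i _ => by rw [mul_smul_comm, hPv]
  have hcancel : ∀ a : UT (n + 1) F, (∀ j, a * v j = 0) → a = 0 := fun a ha => by
    have : a * P = 0 := hinj _ fun j => by rw [mul_assoc, hPv, ha]
    rwa [← hu, Units.mul_left_eq_zero] at this
  have hunit : ∀ (g : G) (w : UT (n + 1) F), w ∈ elementaryGrading F t g →
      P * w * ↑u⁻¹ ∈ 𝒜 g := fun g w hw => by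
    have hmem : ∀ j, (P * w * ↑u⁻¹) * v j ∈ 𝒜 (g * t j) := fun j => by
      rw [hmul]
      refine Submodule.sum_mem _ fun i _ => ?_
      by_cases h0 : w.1 i j = 0
      · rw [h0, zero_smul]
        exact Submodule.zero_mem _
      · refine Submodule.smul_mem _ _ ?_
        have hij : i ≤ j := not_lt.1 fun hlt => h0 (apply_eq_zero w hlt)
        have : t i * (t j)⁻¹ = g := by
          by_contra hne
          exact h0 (hw i j hij hne)
        rw [← this, inv_mul_cancel_right]
        exact hvt i
    -- A component of degree `k ≠ g` kills every `v j`, because the product with `v j` is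
    -- homogeneous of degree `g * t j`; left multiplication on the last column is faithful.
    refine h.mem_of_proj_mem fun k => ?_
    by_cases hk : g = k
    · subst hk
      exact h.proj_mem _ _
    · rw [hcancel (h.proj k _) fun j => ?_]
      · exact Submodule.zero_mem _
      · rw [← h.proj_mul_right k _ (hvt j), h.proj_of_mem_ne (hmem j)]
        exact fun e => hk (mul_right_cancel e)
  refine ⟨t, (unitConj u).symm, fun g a => ?_⟩
  obtain ⟨w, rfl⟩ := (unitConj (F := F) u).surjective a
  rw [AlgEquiv.symm_apply_apply, unitConj_apply, hu]
  refine ⟨hunit g w, fun hw i j hij hg => ?_⟩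
  have hz : h.proj (t i * (t j)⁻¹) (P * w * ↑u⁻¹) = 0 := h.proj_of_mem_ne hw (Ne.symm hg)
  have hcol := hmul w j
  apply_fun h.proj (t i) at hcol
  rw [show t i = t i * (t j)⁻¹ * t j by rw [inv_mul_cancel_right], h.proj_mul_right _ _ (hvt j), hz,
    zero_mul, inv_mul_cancel_right, map_sum] at hcol
  classical
  -- The part of degree `t i` of the `j`-th column of `w` in the basis `v`. It vanishes, and
  -- independence of the `v k` gives `w i j = 0`.
  let x : Fin (n + 1) → F := fun k => if t k = t i then w.1 k j else 0
  have hx : ∑ k, x k • v k = 0 := by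
    rw [hcol]
    refine Finset.sum_congr rfl fun k _ => ?_
    rw [map_smul]
    simp only [x]
    split_ifs with hk
    · rw [← hk, h.proj_of_mem (hvt k)]
    · rw [h.proj_of_mem_ne (hvt k) hk, smul_zero, zero_smul]
  have hx' : P * ∑ k, x k • unit F (Fin.le_last k) = 0 := by
    rw [← hx, Finset.mul_sum]
    exact Finset.sum_congr rfl fun k _ => by rw [mul_smul_comm, hPv]
  rw [← hu, Units.mul_right_eq_zero] at hx'
  have h0 : (∑ k, x k • unit F (Fin.le_last k)).1 i (Fin.last n) = 0 := by rw [hx']; rfl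
  rw [sum_smul_apply] at h0
  simpa [unit_apply, x] using h0

end Column

end UT

namespace UT

variable {F : Type*} [Field F] {m : ℕ}

/-! ### Coarsenings and the universal property of the finest grading -/

section Coarsening

variable {G H : Type*} [Group G] [Group H]

lemma unit_mem_elementaryGrading (t : Fin m → G) {i j : Fin m} (h : i ≤ j) :
    unit F h ∈ elementaryGrading F t (t i * (t j)⁻¹) := fun k l _ hkl => by
  rw [unit_apply, if_neg]
  rintro ⟨rfl, rfl⟩
  exact hkl rfl

lemma eq_sum_unit (a : UT m F) :
    a = ∑ i, ∑ j, if h : i ≤ j then a.1 i j • unit F h else 0 := by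
  have hx : ∀ (k l i j : Fin m), (if h : i ≤ j then a.1 i j • unit F h else 0 : UT m F).1 k l =
      if i = k then if j = l then a.1 i j else 0 else 0 := fun k l i j => by
    split_ifs with h h₁ h₂ h₁ h₂
    · exact (congrArg _ ((unit_apply h k l).trans (if_pos ⟨h₁, h₂⟩))).trans (mul_one _)
    · exact (congrArg _ ((unit_apply h k l).trans (if_neg fun h' => h₂ h'.2))).trans (mul_zero _)
    · exact (congrArg _ ((unit_apply h k l).trans (if_neg fun h' => h₁ h'.1))).trans (mul_zero _)
    · exact (apply_eq_zero a (not_le.1 h)).symm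
    · rfl
    · rfl
  refine Subtype.ext (Matrix.ext fun k l => ?_)
  simp only [AddSubmonoidClass.coe_finsetSum, Matrix.sum_apply, hx]
  simp

lemma inducedCoarsening_elementaryGrading (α : H →* G) (τ : Fin m → H) :
    inducedCoarsening α (elementaryGrading F τ) = elementaryGrading F (fun i => α (τ i)) := by
  funext g
  apply le_antisymm
  · refine iSup₂_le fun k hk a ha i j hij hg => ha i j hij fun h => hg ?_
    rw [← map_inv, ← map_mul, h]
    exact hk
  · intro a ha
    rw [eq_sum_unit a]
    refine Submodule.sum_mem _ fun i _ => Submodule.sum_mem _ fun j _ => ?_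
    split_ifs with h
    · by_cases h0 : a.1 i j = 0
      · rw [h0, zero_smul]
        exact Submodule.zero_mem _
      · refine Submodule.smul_mem _ _ (Submodule.mem_iSup_of_mem (τ i * (τ j)⁻¹)
          (Submodule.mem_iSup_of_mem ?_ (unit_mem_elementaryGrading τ h)))
        rw [Set.mem_preimage, Set.mem_singleton_iff, map_mul, map_inv]
        by_contra hne
        exact h0 (ha i j h hne)
    · exact Submodule.zero_mem _

/-- Elements `s_i` of a group which commute and satisfy `s_i s_{m+1-i} = z` give a homomorphism
on the universal group of the finest grading. -/
lemma exists_monoidHom_finestTuple (s : Fin m → G) (hs : ∀ i j, Commute (s i) (s j)) {z : G}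
    (hz : ∀ i, s i * s i.rev = z) (mid : Fin m) (hmid : (mid : ℕ) = m / 2) :
    ∃ α : Multiplicative (Fin (m / 2) → ℤ) →* G,
      ∀ i, α (Multiplicative.ofAdd (finestTuple m i)) = s i * (s mid)⁻¹ := by
  -- Normalized to be `1` at the middle index, where the finest tuple is `0`.
  let x : Fin m → G := fun i => s i * (s mid)⁻¹
  have hx : ∀ i j, Commute (x i) (x j) := fun i j =>
    ((hs i j).mul_right (hs i mid).inv_right).mul_left
      ((hs mid j).mul_right (hs mid mid).inv_right).inv_left
  let ι : Fin (m / 2) → Fin m := fun k => ⟨k, by omega⟩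
  have hcomm : Pairwise fun k l : Fin (m / 2) => ∀ a b : Multiplicative ℤ,
      Commute (zpowersHom G (x (ι k)) a) (zpowersHom G (x (ι l)) b) := fun k l _ a b =>
    (hx (ι k) (ι l)).zpow_zpow _ _
  let α : Multiplicative (Fin (m / 2) → ℤ) →* G :=
    (MonoidHom.noncommPiCoprod (fun k => zpowersHom G (x (ι k))) hcomm).comp
      (MulEquiv.piMultiplicative fun _ => ℤ).toMonoidHom
  have hstd : ∀ i : Fin m, (i : ℕ) < m / 2 →
      α (Multiplicative.ofAdd (stdVec (m / 2) i)) = x i := fun i hi => by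
    have : (MulEquiv.piMultiplicative fun _ => ℤ) (Multiplicative.ofAdd (stdVec (m / 2) i)) =
        Pi.mulSingle (⟨i, hi⟩ : Fin (m / 2)) (Multiplicative.ofAdd (1 : ℤ)) := by
      funext l
      change Multiplicative.ofAdd (stdVec (m / 2) i l) = _
      by_cases hl : l = ⟨i, hi⟩
      · subst hl
        simp [stdVec]
      · rw [Pi.mulSingle_eq_of_ne hl, stdVec, if_neg fun h => hl (Fin.ext h)]
        rfl
    refine (congrArg (MonoidHom.noncommPiCoprod _ hcomm) this).trans ?_
    rw [MonoidHom.noncommPiCoprod_mulSingle, zpowersHom_apply]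
    simp [ι]
  refine ⟨α, fun i => ?_⟩
  change _ = x i
  -- The constant value of `x i * x i.rev` can be read off at `mid`: it is `1` for odd `m`, and `x
  -- mid.rev`, the image of the last basis vector, for even `m`. This determines `x` on the second
  -- half.
  have hprod : ∀ i, x i * x i.rev = z * (s mid)⁻¹ * (s mid)⁻¹ := fun i => by
    have h : Commute (s mid)⁻¹ (s i.rev) := (hs mid i.rev).inv_left
    simp only [x]
    rw [← hz i, mul_assoc, ← mul_assoc _ (s i.rev), h.eq]
    simp only [mul_assoc]
  have hxmid : x mid = 1 := mul_inv_cancel _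
  have hval : ∀ i : Fin m, m - 1 - (i : ℕ) = i.rev := fun i => by rw [Fin.val_rev]; omega
  unfold finestTuple
  split_ifs with h₁ h₂ h₃
  · exact hstd i h₁
  · rw [ofAdd_zero, map_one, ← hxmid]
    congr 1
    exact Fin.ext (hmid.trans h₂.symm)
  · have hlt : (i.rev : ℕ) < m / 2 := by rw [Fin.val_rev]; omega
    obtain ⟨r, rfl⟩ := h₃
    have hmr : (mid.rev : ℕ) = (r + r) / 2 - 1 := by rw [Fin.val_rev]; omega
    rw [hval i, ← hmr, ofAdd_sub, map_div, hstd _ (by omega), hstd _ hlt, div_eq_iff_eq_mul, hprod i,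
      ← hprod mid, hxmid, one_mul]
  · have hlt : (i.rev : ℕ) < m / 2 := by rw [Fin.val_rev]; omega
    have hmr : mid.rev = mid := by
      rw [Nat.not_even_iff] at h₃
      exact Fin.ext (by rw [Fin.val_rev]; omega)
    rw [hval i, ofAdd_neg, map_inv, hstd _ hlt, inv_eq_iff_mul_eq_one, (hx _ _).eq, hprod i, ← hprod mid, hmr,
      hxmid, one_mul]

end Coarsening

end UT

namespace UT

variable {F : Type*} [Field F]

/-! ### The reflection involution -/

section Reflection

variable {m : ℕ}

lemma reflectionInvolution_apply (a : UT m F) (i j : Fin m) :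
    (reflectionInvolution m F a).1 i j = a.1 j.rev i.rev := rfl

lemma reflectionInvolution_reflectionInvolution (a : UT m F) :
    reflectionInvolution m F (reflectionInvolution m F a) = a :=
  ext_apply fun i j _ => by simp [reflectionInvolution_apply]

lemma reflectionInvolution_mul (a b : UT m F) : reflectionInvolution m F (a * b) =
    reflectionInvolution m F b * reflectionInvolution m F a := ext_apply fun i j _ => by
  rw [reflectionInvolution_apply, mul_apply, mul_apply, ← Equiv.sum_comp Fin.revPerm]
  exact Finset.sum_congr rfl fun k _ => mul_comm _ _

lemma reflectionInvolution_one : reflectionInvolution m F 1 = 1 := by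
  have h := reflectionInvolution_mul (reflectionInvolution m F 1) 1
  rwa [mul_one, reflectionInvolution_reflectionInvolution, mul_one, eq_comm] at h

lemma reflectionInvolution_pow (a : UT m F) (k : ℕ) :
    reflectionInvolution m F (a ^ k) = reflectionInvolution m F a ^ k := by
  induction k with
  | zero => rw [pow_zero, pow_zero, reflectionInvolution_one]
  | succ k ih => rw [pow_succ, reflectionInvolution_mul, ih, pow_succ']

/-- The relation `d x = x^* d` is linear in `x` and passes to powers of a single element. It is
applied to a polynomial square root. -/
lemma semiconjBy_aeval {d u : UT m F} (h : SemiconjBy d u (reflectionInvolution m F u))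
    (f : Polynomial F) :
    SemiconjBy d (Polynomial.aeval u f) (reflectionInvolution m F (Polynomial.aeval u f)) := by
  induction f using Polynomial.induction_on' with
  | add p q hp hq =>
    rw [map_add, map_add]
    exact hp.add_right hq
  | monomial k c =>
    rw [Polynomial.aeval_monomial, ← Algebra.smul_def, map_smul, reflectionInvolution_pow]
    change d * c • u ^ k = c • reflectionInvolution m F u ^ k * d
    rw [mul_smul_comm, smul_mul_assoc, (h.pow_right k).eq]

end Reflection

/-! ### Degree-one matrices and the normal form of the matrix of an involution -/

section DegreeOne

variable {m : ℕ} {G : Type*} [Group G] (t : Fin m → G)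

lemma mul_mem_elementaryGrading {t : Fin m → G} {g k : G} {a b : UT m F}
    (ha : a ∈ elementaryGrading F t g) (hb : b ∈ elementaryGrading F t k) :
    a * b ∈ elementaryGrading F t (g * k) := fun i j _ hij => by
  rw [mul_apply]
  refine Finset.sum_eq_zero fun l _ => ?_
  by_contra h
  have h₁ := left_ne_zero_of_mul h
  have h₂ := right_ne_zero_of_mul h
  have e₁ : t i * (t l)⁻¹ = g := by
    by_contra hne
    exact h₁ (ha i l (not_lt.1 fun hlt => h₁ (apply_eq_zero a hlt)) hne)
  have e₂ : t l * (t j)⁻¹ = k := by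
    by_contra hne
    exact h₂ (hb l j (not_lt.1 fun hlt => h₂ (apply_eq_zero b hlt)) hne)
  apply hij
  rw [← e₁, ← e₂]
  group

lemma diag_mem_elementaryGrading (d : Fin m → F) : diag d ∈ elementaryGrading F t 1 :=
  fun i j _ hg => by
    rw [diag_apply, if_neg]
    rintro rfl
    exact hg (mul_inv_cancel _)

/-- The component of degree one of an elementary grading, as a subalgebra. -/
def degreeOne : Subalgebra F (UT m F) where
  carrier := {a | a ∈ elementaryGrading F t 1}
  mul_mem' ha hb := by
    have := mul_mem_elementaryGrading ha hb
    rwa [one_mul] at this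
  add_mem' ha hb := (elementaryGrading F t 1).add_mem ha hb
  algebraMap_mem' c := by
    have : algebraMap F (UT m F) c = diag fun _ => c :=
      Subtype.ext (Matrix.algebraMap_eq_diagonal c)
    rw [this]
    exact diag_mem_elementaryGrading t _

/-- By finite dimension the inverse of `p` also has degree one, so conjugation in either direction
preserves degrees. -/
lemma unitConj_mem_elementaryGrading_iff {t : Fin m → G} {p : (UT m F)ˣ}
    (hp : (p : UT m F) ∈ degreeOne t) (g : G) (a : UT m F) :
    unitConj (F := F) p a ∈ elementaryGrading F t g ↔ a ∈ elementaryGrading F t g := by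
  obtain ⟨q, hq, hpq, -⟩ := (degreeOne t).exists_mul_eq_one_of_isUnit hp p.isUnit
  rw [← Units.inv_eq_of_mul_eq_one_right hpq] at hq
  have key : ∀ {x y b : UT m F}, x ∈ degreeOne t → y ∈ degreeOne t →
      b ∈ elementaryGrading F t g → x * b * y ∈ elementaryGrading F t g := fun hx hy hb => by
    have := mul_mem_elementaryGrading (mul_mem_elementaryGrading hx hb) hy
    rwa [one_mul, mul_one] at this
  rw [unitConj_apply]
  refine ⟨fun h => ?_, key hp hq⟩
  have := key hq hp h
  rwa [mul_assoc, mul_assoc, Units.inv_mul, mul_one, ← mul_assoc, Units.inv_mul, one_mul] at this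

/-- An involution given by a matrix `c p^* T p` is conjugate to the one given by `T`. -/
lemma isomorphicGradedInvolution_of_eq {t : Fin m → G} {σ τ : UT m F →ₗ[F] UT m F}
    {u p T : UT m F} {c : F} (hc : c ≠ 0) (hp : p ∈ degreeOne t) (hpu : IsUnit p) (hT : T * T = 1)
    (hu : u = c • (reflectionInvolution m F p * T * p))
    (hσ : ∀ a, u * σ a = reflectionInvolution m F a * u)
    (hτ : ∀ a, τ a = T * reflectionInvolution m F a * T) :
    IsomorphicGradedInvolution (elementaryGrading F t) σ (elementaryGrading F t) τ := by
  obtain ⟨p, rfl⟩ := hpu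
  refine ⟨unitConj p, unitConj_mem_elementaryGrading_iff hp, fun a => ?_⟩
  rw [hτ, unitConj_apply, unitConj_apply, reflectionInvolution_mul, reflectionInvolution_mul]
  have h₁ := hσ a
  rw [hu, smul_mul_assoc, mul_smul_comm] at h₁
  replace h₁ := smul_right_injective _ hc h₁
  have h₂ : reflectionInvolution m F (p⁻¹ : (UT m F)ˣ) * reflectionInvolution m F p = 1 := by
    rw [← reflectionInvolution_mul, Units.mul_inv, reflectionInvolution_one]
  simp only [mul_assoc] at h₁ ⊢
  replace h₁ := congrArg (fun x => T * (reflectionInvolution m F (p⁻¹ : (UT m F)ˣ) *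
    (x * (p⁻¹ : (UT m F)ˣ)))) h₁
  simp only [mul_assoc, Units.mul_inv, mul_one] at h₁
  rw [← mul_assoc _ (reflectionInvolution m F (p : UT m F)) (T * _), h₂, one_mul,
    ← mul_assoc T T, hT, one_mul] at h₁
  exact h₁

/-- The diagonal entries of `signMatrix`. -/
def signDiag (m : ℕ) (F : Type*) [Field F] (i : Fin m) : F := if (i : ℕ) < m / 2 then 1 else -1

lemma signDiag_rev (hm : Even m) (i : Fin m) : signDiag m F i.rev = -signDiag m F i := by
  obtain ⟨r, rfl⟩ := hm
  unfold signDiag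
  rw [Fin.val_rev]
  split_ifs with h₁ h₂ h₂ <;> first | omega | simp

lemma diag_mul_diag_eq_one {d : Fin m → F} (hd : ∀ i, d i * d i = 1) : diag d * diag d = 1 :=
  Subtype.ext <| (Matrix.diagonal_mul_diagonal d d).trans <|
    (congrArg Matrix.diagonal (funext hd)).trans Matrix.diagonal_one

lemma signDiag_mul_self (i : Fin m) : signDiag m F i * signDiag m F i = 1 := by
  unfold signDiag
  split_ifs <;> simp

lemma symplecticInvolution_eq (a : UT m F) : symplecticInvolution m F a =
    diag (signDiag m F) * reflectionInvolution m F a * diag (signDiag m F) := by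
  have h : signMatrix m F * signMatrix m F = 1 :=
    congrArg Subtype.val (diag_mul_diag_eq_one (signDiag_mul_self (F := F) (m := m)))
  refine Subtype.ext ?_
  change signMatrix m F * (reflectionInvolution m F a).1 * (signMatrix m F)⁻¹ = _
  rw [Matrix.inv_eq_right_inv h]
  rfl

/-- A diagonal matrix which is symmetric up to the same sign as `T` is a multiple of `q^* T q`. -/
lemma exists_diag_eq (hm : 0 < m) {d τ : Fin m → F} (hd : ∀ i, d i ≠ 0)
    (hτ : ∀ i, τ i * τ i = 1) (hdτ : ∀ i : Fin m, d i.rev * τ i.rev = d i * τ i) :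
    ∃ (q : Fin m → F) (c : F), c ≠ 0 ∧ (∀ i, q i ≠ 0) ∧
      diag d = c • (reflectionInvolution m F (diag q) * diag τ * diag q) := by
  have hτ0 : ∀ i, τ i ≠ 0 := fun i h => by simpa [h] using hτ i
  let mid : Fin m := ⟨m / 2, by omega⟩
  -- For odd `m` the middle entry requires `c * q mid ^ 2 = d mid * τ mid`; this `c` permits `q mid
  -- = 1`. The other indices pair off, and `q` carries all the weight on the second half.
  let c := d mid * τ mid
  have hc : c ≠ 0 := mul_ne_zero (hd _) (hτ0 _)
  let q : Fin m → F := fun i => if i ≤ i.rev then 1 else d i * τ i / c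
  have hq : ∀ i, c * (q i.rev * q i) = d i * τ i := fun i => by
    simp only [q, Fin.rev_rev]
    rcases lt_trichotomy i i.rev with h | h | h
    · rw [if_neg (not_le.2 h), if_pos h.le, mul_one, hdτ, mul_div_cancel₀ _ hc]
    · have hi : i = mid := by
        have := congrArg Fin.val h
        rw [Fin.val_rev] at this
        exact Fin.ext (by simp only [mid]; omega)
      rw [if_pos h.ge, if_pos h.le, mul_one, mul_one, hi]
    · rw [if_pos h.le, if_neg (not_le.2 h), one_mul, mul_div_cancel₀ _ hc]
  refine ⟨q, c, hc, fun i => ?_, ext_apply fun i j _ => ?_⟩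
  · simp only [q]
    split_ifs
    · exact one_ne_zero
    · exact div_ne_zero (mul_ne_zero (hd _) (hτ0 _)) hc
  · change _ = c * (reflectionInvolution m F (diag q) * diag τ * diag q).1 i j
    rw [mul_diag_apply, mul_diag_apply, reflectionInvolution_apply, diag_apply, diag_apply]
    by_cases hij : i = j
    · subst hij
      rw [if_pos rfl, if_pos rfl, show c * (q i.rev * τ i * q i) = c * (q i.rev * q i) * τ i by ring,
        hq, mul_assoc, hτ, mul_one]
    · rw [if_neg hij, if_neg fun h => hij (Fin.rev_injective h).symm]
      ring

/-- A matrix of degree one which is symmetric or skew-symmetric with respect to the reflection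
is a multiple of `p^* p` or of `p^* T p`, where `T` is the sign matrix. -/
lemma exists_factorization (hF : (2 : F) ≠ 0) (hm : 0 < m) {t : Fin m → G} {u : UT m F}
    (hu : ∀ i, u.1 i i ≠ 0) (hut : u ∈ degreeOne t) {ε : F} (hε : ε * ε = 1)
    (hsymm : reflectionInvolution m F u = ε • u) :
    ∃ (p T : UT m F) (c : F), c ≠ 0 ∧ p ∈ degreeOne t ∧ IsUnit p ∧ T * T = 1 ∧
      u = c • (reflectionInvolution m F p * T * p) ∧
      (T = 1 ∨ Even m ∧ T = diag (signDiag m F)) := by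
  have hε0 : ε ≠ 0 := fun h => by simp [h] at hε
  let d : Fin m → F := fun i => u.1 i i
  have hentry : ∀ i j : Fin m, u.1 j.rev i.rev = ε * u.1 i j := fun i j =>
    congrFun (congrFun (congrArg Subtype.val hsymm) i) j
  have hd : ∀ i : Fin m, d i.rev = ε * d i := fun i => hentry i i
  let w : UT m F := diag (fun i => (d i)⁻¹) * u
  have hw : ∀ i j, w.1 i j = (d i)⁻¹ * u.1 i j := fun i j => diag_mul_apply _ _ _ _
  have hwd : ∀ i, w.1 i i = 1 := fun i => (hw i i).trans (inv_mul_cancel₀ (hu i))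
  have hdw : diag d * w = u := ext_apply fun i j _ => by
    rw [diag_mul_apply, hw, mul_inv_cancel_left₀ (hu i)]
  have hnil : IsNilpotent (w - 1) := isNilpotent_of_diag_eq_zero fun i => by
    change w.1 i i - (1 : Matrix (Fin m) (Fin m) F) i i = 0
    rw [hwd, Matrix.one_apply_eq, sub_self]
  obtain ⟨f, hf⟩ := exists_aeval_sq_eq hF hnil
  -- Both `u = d w` and `d` are multiplied by `ε` under reflection, so the sign cancels: `d w = w^*
  -- d`. With `r ^ 2 = w` this gives `u = d r r = r^* d r`.
  have hsemi : SemiconjBy (diag d) w (reflectionInvolution m F w) := by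
    refine hdw.trans (ext_apply fun i j _ => ?_)
    rw [mul_diag_apply, reflectionInvolution_apply, hw, hentry, hd]
    have := hu j
    change d j ≠ 0 at this
    field_simp
  have hr := semiconjBy_aeval hsemi f
  set r := Polynomial.aeval w f
  have hwt : w ∈ degreeOne t := (degreeOne t).mul_mem (diag_mem_elementaryGrading t _) hut
  have hrt : r ∈ degreeOne t := Algebra.adjoin_le (by simpa using hwt)
    (Polynomial.aeval_mem_adjoin_singleton F w)
  have hru : IsUnit r := isUnit_of_diag_ne_zero fun i h => by
    have := hwd i
    rw [← hf, pow_two, diag_mul, h, mul_zero] at this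
    exact zero_ne_one this
  have hur : u = reflectionInvolution m F r * diag d * r := by
    rw [← hr.eq, mul_assoc, ← pow_two, hf, hdw]
  have main : ∀ τ : Fin m → F, (∀ i, τ i * τ i = 1) → (∀ i : Fin m, τ i.rev = ε * τ i) →
      (diag τ = 1 ∨ Even m ∧ diag τ = diag (signDiag m F)) →
      ∃ (p T : UT m F) (c : F), c ≠ 0 ∧ p ∈ degreeOne t ∧ IsUnit p ∧ T * T = 1 ∧
        u = c • (reflectionInvolution m F p * T * p) ∧
        (T = 1 ∨ Even m ∧ T = diag (signDiag m F)) := fun τ h₁ h₂ h₃ => by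
    obtain ⟨q, c, hc, hq, hdq⟩ := exists_diag_eq hm hu h₁ fun i => by
      change d i.rev * τ i.rev = d i * τ i
      rw [hd, h₂, mul_mul_mul_comm, hε, one_mul]
    refine ⟨diag q * r, diag τ, c, hc, (degreeOne t).mul_mem (diag_mem_elementaryGrading t _) hrt,
      (isUnit_of_diag_ne_zero fun i => ?_).mul hru, diag_mul_diag_eq_one h₁, ?_, h₃⟩
    · rw [diag_apply, if_pos rfl]
      exact hq i
    · change diag d = _ at hdq
      rw [hur, hdq, reflectionInvolution_mul, mul_smul_comm, smul_mul_assoc]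
      simp only [mul_assoc]
  rcases mul_self_eq_one_iff.1 hε with rfl | rfl
  · exact main (fun _ => 1) (fun _ => mul_one 1) (fun _ => (mul_one 1).symm)
      (Or.inl (Subtype.ext Matrix.diagonal_one))
  -- For odd `m` the central diagonal entry of a skew-symmetric matrix is fixed by reflection, hence
  -- zero.
  · have heven : Even m := by
      by_contra hodd
      rw [Nat.not_even_iff] at hodd
      let mid : Fin m := ⟨m / 2, by omega⟩
      have hmid : mid.rev = mid := Fin.ext (by rw [Fin.val_rev]; simp only [mid]; omega)
      have h := hd mid
      rw [hmid] at h
      have h2 : 2 * d mid = 0 := by linear_combination h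
      exact (mul_ne_zero hF (hu mid)) h2
    exact main (signDiag m F) signDiag_mul_self (fun i => by rw [signDiag_rev heven]; ring)
      (Or.inr ⟨heven, rfl⟩)

end DegreeOne

/-! ### Graded involutions on elementary gradings -/

section Elementary

variable {n : ℕ} {G : Type*} [Group G] {t : Fin (n + 1) → G}
  {σ : UT (n + 1) F →ₗ[F] UT (n + 1) F}

/-- An involution `σ` of `UT_m(F)` is of the form `a ↦ u⁻¹ a^* u`, with `u` symmetric or
skew-symmetric. -/
lemma exists_involution_matrix (hσ : IsAlgInvolution σ) :
    ∃ u : UT (n + 1) F,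
      (∀ i j, u.1 i j = (σ (unit F (Fin.le_last i.rev))).1 0 j) ∧ (∀ i, u.1 i i ≠ 0) ∧
      (∀ a, u * σ a = reflectionInvolution (n + 1) F a * u) ∧
      ∃ ε : F, ε * ε = 1 ∧ reflectionInvolution (n + 1) F u = ε • u := by
  let e : Fin (n + 1) → UT (n + 1) F := fun i => unit F (Fin.le_last i)
  have he : ∀ i : Fin (n + 1), e i ∈ column n F (i + 1) := fun i k l h => by
    simp only [e, unit_apply] at h
    obtain ⟨rfl, rfl⟩ := of_not_not fun h' => h (if_neg h')
    exact ⟨rfl, Nat.lt_succ_self _⟩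
  have hrow : ∀ i : Fin (n + 1), σ (e i) ∈ row n F (i + 1) := fun i => map_mem_row hσ _ _ (he i)
  have hrow0 : ∀ i k l, k ≠ 0 → (σ (e i)).1 k l = 0 := fun i k l hk => by
    by_contra h
    exact hk (hrow i k l h).1
  let u : UT (n + 1) F := ⟨Matrix.of fun i j => (σ (e i.rev)).1 0 j, fun i j hij => by
    by_contra h
    have h₁ := (hrow i.rev 0 j h).2
    have h₂ : (j : ℕ) < i := hij
    rw [Fin.val_rev] at h₁
    omega⟩
  have hu : ∀ i j, u.1 i j = (σ (e i.rev)).1 0 j := fun _ _ => rfl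
  -- The `σ (e i)` live in the first row, so a relation between the rows of `u` is one between the
  -- `σ (e i)`, excluded by injectivity of `σ`.
  have hdet : u.1.det ≠ 0 := fun h0 => by
    obtain ⟨v, hv, hvu⟩ := Matrix.exists_vecMul_eq_zero_iff.2 h0
    have hy : σ (∑ i, v i • e i.rev) = 0 := by
      rw [map_sum]
      simp only [map_smul]
      refine ext_apply fun k l _ => ?_
      rw [sum_smul_apply]
      by_cases hk : k = 0
      · subst hk
        exact congrFun hvu l
      · exact Finset.sum_eq_zero fun i _ => by rw [hrow0 _ _ _ hk, mul_zero]
    have hy' : ∑ i, v i • e i.rev = 0 := by rw [← hσ.apply_apply (∑ i, _), hy, map_zero]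
    refine hv (funext fun i => ?_)
    have h1 : (∑ i, v i • e i.rev).1 i.rev (Fin.last n) = 0 := by rw [hy']; rfl
    rw [sum_smul_apply] at h1
    simpa [e, unit_apply] using h1
  have hdiag : ∀ i, u.1 i i ≠ 0 := fun i => by
    rw [Matrix.det_of_isUpperTriangular u.2] at hdet
    exact Finset.prod_ne_zero_iff.1 hdet i (Finset.mem_univ i)
  -- `u` is the matrix of the form `(e i, e j) ↦ σ (e i) * e j` with values in the line of `e 0`;
  -- applying `σ` to this identity gives its symmetry, with `ε` defined by `σ (e 0) = ε • e 0`.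
  have hform : ∀ i j, σ (e i) * e j = u.1 i.rev j • e 0 := fun i j => ext_apply fun k l _ => by
    change _ = u.1 i.rev j * (e 0).1 k l
    simp only [e, mul_unit_apply, unit_apply, hu, Fin.rev_rev]
    by_cases hk : k = 0
    · subst hk
      simp
    · have h0 : ¬(0 = k ∧ Fin.last n = l) := fun h => hk h.1.symm
      simp only [h0, if_false, mul_zero]
      split_ifs
      · exact hrow0 i k j hk
      · rfl
  refine ⟨u, hu, hdiag, fun a => ext_apply fun k l _ => ?_, u.1 (Fin.last n) (Fin.last n), ?_⟩
  · have h : σ (e k.rev) * σ a = ∑ i, a.1 i k.rev • σ (e i) := by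
      rw [← hσ.map_mul, mul_unit_last, map_sum]
      simp only [map_smul, e]
    have h' : (σ (e k.rev) * σ a).1 0 l = ∑ i, a.1 i k.rev * (σ (e i)).1 0 l := by
      rw [h, sum_smul_apply]
    rw [mul_apply] at h' ⊢
    rw [mul_apply]
    refine h'.trans ?_
    rw [← Equiv.sum_comp Fin.revPerm]
    rfl
  · have hsymm : reflectionInvolution (n + 1) F u = u.1 (Fin.last n) (Fin.last n) • u :=
      ext_apply fun i j _ => by
        have h := congrArg σ (hform i.rev j)
        rw [hσ.map_mul, hσ.apply_apply, hform, map_smul, Fin.rev_rev] at h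
        have h' : u.1 j.rev i.rev * (e 0).1 0 (Fin.last n) =
            u.1 i j * (σ (e 0)).1 0 (Fin.last n) :=
          congrFun (congrFun (congrArg Subtype.val h) 0) (Fin.last n)
        have h'' : (σ (e 0)).1 0 (Fin.last n) = u.1 (Fin.last n) (Fin.last n) := by
          rw [hu, Fin.rev_last]
        rw [h''] at h'
        change _ = u.1 (Fin.last n) (Fin.last n) * u.1 i j
        rw [reflectionInvolution_apply, mul_comm, ← h']
        simp [e, unit_apply]
    refine ⟨?_, hsymm⟩
    have h := congrArg (reflectionInvolution (n + 1) F) hsymm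
    rw [reflectionInvolution_reflectionInvolution, map_smul, hsymm, smul_smul] at h
    have h' : u.1 (Fin.last n) (Fin.last n) = u.1 (Fin.last n) (Fin.last n) *
        u.1 (Fin.last n) (Fin.last n) * u.1 (Fin.last n) (Fin.last n) :=
      congrFun (congrFun (congrArg Subtype.val h) _) _
    exact mul_right_cancel₀ (hdiag (Fin.last n)) (by rw [one_mul, ← h'])

/-- The case of an elementary grading. -/
theorem exists_isomorphic_of_elementaryGrading (hF : (2 : F) ≠ 0)
    (hσ : IsGradedInvolution (elementaryGrading F t) σ) :
    ∃ α : Multiplicative (Fin ((n + 1) / 2) → ℤ) →* G,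
      IsomorphicGradedInvolution (elementaryGrading F t) σ
          (inducedCoarsening α (finestGrading (n + 1) F)) (reflectionInvolution (n + 1) F) ∨
        (Even (n + 1) ∧
          IsomorphicGradedInvolution (elementaryGrading F t) σ
            (inducedCoarsening α (finestGrading (n + 1) F)) (symplecticInvolution (n + 1) F)) := by
  obtain ⟨u, hu, hdiag, huσ, ε, hε, hsymm⟩ := exists_involution_matrix hσ.toIsAlgInvolution
  have hdeg : ∀ i j, u.1 i j ≠ 0 → t 0 * (t j)⁻¹ = t i.rev * (t (Fin.last n))⁻¹ :=
    fun i j hij => by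
      by_contra hne
      refine hij ((hu i j).trans ?_)
      exact hσ.map_mem _ _ (unit_mem_elementaryGrading t (Fin.le_last i.rev)) 0 j (Fin.zero_le _) hne
  have hut : u ∈ degreeOne t := fun i j _ hne => by
    by_contra h
    have h₁ := (hdeg i j h).trans (hdeg i i (hdiag i)).symm
    rw [mul_right_inj, inv_inj] at h₁
    exact hne (by rw [h₁, mul_inv_cancel])
  let s : Fin (n + 1) → G := fun i => t i * (t (Fin.last n))⁻¹
  -- Applying `σ` to `e_{ij} e_{jm} = e_{im}` and comparing degrees gives `s i = s j * (s i * (s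
  -- j)⁻¹)`.
  have hcomm_le : ∀ i j, i ≤ j → Commute (s i) (s j) := fun i j hij => by
    have hi := hσ.map_mem _ _ (unit_mem_elementaryGrading (F := F) t hij)
    have hj := hσ.map_mem _ _ (unit_mem_elementaryGrading (F := F) t (Fin.le_last j))
    have hmul : unit F hij * unit F (Fin.le_last j) = unit F (Fin.le_last i) :=
      ext_apply fun k l _ => by simp [unit_mul_apply, unit_apply, ite_and]
    have hji := mul_mem_elementaryGrading hj hi
    rw [← hσ.map_mul, hmul] at hji
    have h0 : (σ (unit F (Fin.le_last i))).1 0 i.rev ≠ 0 := by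
      have := hdiag i.rev
      rwa [hu, Fin.rev_rev] at this
    have h₁ : t 0 * (t i.rev)⁻¹ = s j * (t i * (t j)⁻¹) := by
      by_contra hne
      exact h0 (hji 0 i.rev (Fin.zero_le _) hne)
    have h₂ : t 0 * (t i.rev)⁻¹ = s i := by
      have := hdeg i.rev i.rev (hdiag _)
      rwa [Fin.rev_rev] at this
    rw [h₂] at h₁
    have h₃ : t i * (t j)⁻¹ = s i * (s j)⁻¹ := by simp only [s]; group
    rw [h₃, eq_comm, ← mul_assoc, mul_inv_eq_iff_eq_mul] at h₁
    exact h₁.symm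
  have hcomm : ∀ i j, Commute (s i) (s j) := fun i j => (le_total i j).elim (hcomm_le i j)
    fun h => (hcomm_le j i h).symm
  have hz : ∀ i : Fin (n + 1), s i * s i.rev = s 0 := fun i => by
    have h : s i.rev = s 0 * (s i)⁻¹ := by
      simp only [s]
      rw [← hdeg i i (hdiag i)]
      group
    rw [h, ← mul_assoc, (hcomm i 0).eq, mul_inv_cancel_right]
  obtain ⟨α, hα⟩ := exists_monoidHom_finestTuple s hcomm hz ⟨(n + 1) / 2, by omega⟩ rfl
  -- Right translation of the tuple by a fixed group element does not change an elementary grading.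
  have hgr : inducedCoarsening α (finestGrading (n + 1) F) = elementaryGrading F t := by
    rw [finestGrading, inducedCoarsening_elementaryGrading]
    have h : ∀ i j : Fin (n + 1), α (Multiplicative.ofAdd (finestTuple (n + 1) i)) *
        (α (Multiplicative.ofAdd (finestTuple (n + 1) j)))⁻¹ = t i * (t j)⁻¹ := fun i j => by
      rw [hα, hα]
      simp only [s]
      group
    funext g
    ext a
    change (∀ i j, _ → _ → _) ↔ ∀ i j, _ → _ → _
    simp only [h]
  obtain ⟨p, T, c, hc, hpt, hpu, hT, hup, hT'⟩ :=
    exists_factorization hF n.succ_pos hdiag hut hε hsymm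
  refine ⟨α, ?_⟩
  rw [hgr]
  rcases hT' with rfl | ⟨heven, rfl⟩
  · exact Or.inl (isomorphicGradedInvolution_of_eq hc hpt hpu hT hup huσ fun a => by
      rw [one_mul, mul_one])
  · exact Or.inr ⟨heven, isomorphicGradedInvolution_of_eq hc hpt hpu hT hup huσ
      symplecticInvolution_eq⟩

end Elementary

end UT

theorem mainTheorem3 {F : Type*} [Field F] (hF : (2 : F) ≠ 0) {G : Type*} [Group G]
    (m : ℕ) (hm : 0 < m) (𝒜 : G → Submodule F (UT m F)) (h𝒜 : IsGroupGrading 𝒜)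
    (σ : UT m F →ₗ[F] UT m F) (hσ : IsGradedInvolution 𝒜 σ) :
    ∃ α : Multiplicative (Fin (m / 2) → ℤ) →* G,
      IsomorphicGradedInvolution 𝒜 σ
          (inducedCoarsening α (finestGrading m F)) (reflectionInvolution m F) ∨
        (Even m ∧
          IsomorphicGradedInvolution 𝒜 σ
            (inducedCoarsening α (finestGrading m F)) (symplecticInvolution m F)) := by
  obtain ⟨n, rfl⟩ := Nat.exists_eq_succ_of_ne_zero hm.ne'
  obtain ⟨t, φ, hφ⟩ := UT.exists_equiv_elementaryGrading h𝒜 hσ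
  obtain ⟨τ, hτ, hiso⟩ := exists_isomorphicGradedInvolution hσ φ hφ
  obtain ⟨α, h | ⟨heven, h⟩⟩ := UT.exists_isomorphic_of_elementaryGrading hF hτ
  · exact ⟨α, Or.inl (hiso.trans h)⟩
  · exact ⟨α, Or.inr ⟨heven, hiso.trans h⟩⟩
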